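/- Let $n_x,n_z\ge 1$, $A\in\mathbb R^{n_x\times n_x}$, $B\in\mathbb R^{n_x\times n_z}$, $C\in\mathbb R^{n_z\times n_x}$, $D\in\mathbb R^{n_z\times n_z}$. For an integer $n\ge 1$ and a real $T>0$ consider the sampled-data system $$\dot x(t)=Ax(t)+Bz(t),\qquad z(t)=z_k\ \text{ for } t\in[kT,(k+1)T),\ k\ge 0,\qquad z_k=\sum_{i=0}^{n-1}D^iC\,x(kT)+D^nz_{k-1}\ \text{ for } k\ge 1,$$ with arbitrary initial state $y(0)=(x(0),z(0))$, $z(0)=z_0$, where $y(t)=(x(t),z(t))$, $x$ is continuous on $[0,\infty)$, and the differential equation holds on each interval $(kT,(k+1)T)$. Write $\rho(M)$ for the spectral radius of a real square matrix $M$; $M$ is Schur if $\rho(M)<1$, and Hurwitz if all its complex eigenvalues have negative real part. For norms on $\mathbb R^{n_x}$ and $\mathbb R^{n_z}$ let $\|M\|$ denote the correspondingly induced matrix norm of $M$, and let $\mu_X(M)=\lim_{h\to0^+}(\|I+hM\|_X-1)/h$ be the logarithmic norm of $M\in\mathbb R^{n_x\times n_x}$ induced by the norm $\|\cdot\|_X$.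 Assume that $A+B(I-D)^{-1}C$ is Hurwitz and that $D$ is Schur. Call norms $\|\cdot\|_X$ on $\mathbb R^{n_x}$, $\|\cdot\|_Z$ on $\mathbb R^{n_z}$ and real constants $\ell_A,\ell_B,\ell_C,\ell_D,\xi,\zeta$ admissible if $\|A\|_{X\to X}\le\ell_A$, $\|B\|_{Z\to X}\le\ell_B$, $\|C\|_{X\to Z}\le\ell_C$, $\|D\|_{Z\to Z}\le\ell_D<1$, $\ell_B>0$, $\ell_C>0$, $\mu_X(A)\le\xi$, $\zeta>0$ and $\mu_X(A+B(I-D)^{-1}C)\le-\zeta$. For admissible data put $$C_1=\frac{\ell_B\ell_C}{1-\ell_D}\Big(\ell_A+\frac{\ell_B\ell_C}{1-\ell_D}\Big),\qquad C_2(n)=\ell_D^{\,n}\,\frac{\ell_C\ell_B}{1-\ell_D},$$ $$T(n)=\begin{cases}\dfrac1\xi\log\Big(\dfrac{\xi(1-\ell_D^{\,n})}{C_2(n)+C_1/\zeta}+1\Big),&\xi\ne0,\\[2ex]\dfrac{1-\ell_D^{\,n}}{C_2(n)+C_1/\zeta},&\xi=0,\end{cases}$$ where $T(n)=+\infty$ if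 $\xi\neq 0$ and the argument of the logarithm is $\le 0$ (which can happen only for $\xi<0$). Then admissible data exist. Moreover, for all admissible data and every integer $n\ge1$, one has $T(n)>0$, and the following holds for every real $T$ with $0<T<T(n)$. 1. The matrix $\mathcal L=\mathcal L(n,T)\in\mathbb R^{(n_x+n_z)\times(n_x+n_z)}$ with blocks $$\mathcal L_{11}=e^{AT},\quad \mathcal L_{12}=\Big(\int_0^Te^{A(T-s)}\,ds\Big)B,\quad \mathcal L_{21}=(I-D^n)(I-D)^{-1}Ce^{AT},\quad \mathcal L_{22}=(I-D^n)(I-D)^{-1}C\mathcal L_{12}+D^n$$ is Schur. 2. There is a norm $\|\cdot\|$ on $\mathbb R^{n_x+n_z}$ such that any two solutions $y,\bar y$ of the system satisfy, for every integer $k\ge0$, $$\|y(kT)-\bar y(kT)\|\le\Big(\frac{1+\rho(\mathcal L(n,T))}2\Big)^k\|y(0)-\bar y(0)\|.$$ 3. The origin is globally exponentially stable: for every norm $\|\cdot\|$ on $\mathbb R^{n_x+n_z}$ there are constants $a>0$ and $r\ge0$ such that every solution satisfies $\|y(t)\|\le re^{-at}\|y(0)\|$ for all $t\ge0$. -/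

import Mathlib

open scoped Matrix Topology

noncomputable section

namespace SampledLTI

/-- A seminorm on a real vector space is a norm if it vanishes only at the origin. -/
def IsNorm {E : Type*} [AddCommGroup E] [Module ℝ E] (p : Seminorm ℝ E) : Prop :=
  ∀ v, p v = 0 → v = 0

/-- Induced matrix norm `max {‖M v‖_q : ‖v‖_p = 1}`. -/
def opNorm {k m : ℕ} (p : Seminorm ℝ (Fin k → ℝ)) (q : Seminorm ℝ (Fin m → ℝ))
    (M : Matrix (Fin m) (Fin k) ℝ) : ℝ :=
  sSup {r : ℝ | ∃ v, p v = 1 ∧ r = q (M *ᵥ v)}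

/-- `m` is the logarithmic norm of `M` induced by `p`, the limit of `(‖I + h M‖ - 1) / h`
as `h → 0⁺`. -/
def HasLogNorm {k : ℕ} (p : Seminorm ℝ (Fin k → ℝ)) (M : Matrix (Fin k) (Fin k) ℝ)
    (m : ℝ) : Prop :=
  Filter.Tendsto (fun h : ℝ => (opNorm p p (1 + h • M) - 1) / h) (𝓝[>] 0) (𝓝 m)

/-- The logarithmic norm of `M` induced by `p` is at most `c`. -/
def LogNormLE {k : ℕ} (p : Seminorm ℝ (Fin k → ℝ)) (M : Matrix (Fin k) (Fin k) ℝ)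
    (c : ℝ) : Prop :=
  ∃ m, HasLogNorm p M m ∧ m ≤ c

section Spectrum

variable {ι : Type*} [Fintype ι] [DecidableEq ι]

/-- Largest modulus of the complex eigenvalues of a real matrix. -/
def specRad (M : Matrix ι ι ℝ) : ℝ :=
  (spectralRadius ℂ (M.map (algebraMap ℝ ℂ))).toReal

/-- The spectral radius is less than one. -/
def IsSchur (M : Matrix ι ι ℝ) : Prop :=
  spectralRadius ℂ (M.map (algebraMap ℝ ℂ)) < 1

/-- All complex eigenvalues have negative real part. -/
def IsHurwitz (M : Matrix ι ι ℝ) : Prop :=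
  ∀ l ∈ spectrum ℂ (M.map (algebraMap ℝ ℂ)), l.re < 0

end Spectrum

/-- `A + B (I - D)⁻¹ C`, the matrix of the reduced model. -/
def reducedMatrix {nx nz : ℕ} (A : Matrix (Fin nx) (Fin nx) ℝ) (B : Matrix (Fin nx) (Fin nz) ℝ)
    (C : Matrix (Fin nz) (Fin nx) ℝ) (D : Matrix (Fin nz) (Fin nz) ℝ) :
    Matrix (Fin nx) (Fin nx) ℝ :=
  A + B * (1 - D)⁻¹ * C

/-- `(x, z)` is a solution, for `t ≥ 0`, of the interconnection with sampling interval `T` and `n`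
iterations per sample: `x` is continuous, solves `ẋ = A x + B z` between sampling instants, and
`z` equals `zs k` on `[kT, (k+1)T)`. The initial value `zs 0 = z 0` is arbitrary. -/
structure IsSolution {nx nz : ℕ} (A : Matrix (Fin nx) (Fin nx) ℝ)
    (B : Matrix (Fin nx) (Fin nz) ℝ) (C : Matrix (Fin nz) (Fin nx) ℝ)
    (D : Matrix (Fin nz) (Fin nz) ℝ) (n : ℕ) (T : ℝ)
    (x : ℝ → Fin nx → ℝ) (z : ℝ → Fin nz → ℝ) : Prop where
  continuousOn : ContinuousOn x (Set.Ici 0)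
  ode : ∀ k : ℕ, ∀ t ∈ Set.Ioo ((k : ℝ) * T) (((k : ℝ) + 1) * T),
    HasDerivAt x (A *ᵥ x t + B *ᵥ z t) t
  sampled : ∃ zs : ℕ → Fin nz → ℝ,
    (∀ k : ℕ, zs (k + 1) =
      (∑ i ∈ Finset.range n, D ^ i * C) *ᵥ x (((k : ℝ) + 1) * T) + D ^ n *ᵥ zs k) ∧
    ∀ k : ℕ, ∀ t ∈ Set.Ico ((k : ℝ) * T) (((k : ℝ) + 1) * T), z t = zs k

/-- The full state `y(t) = (x(t), z(t))`. -/
def state {nx nz : ℕ} (x : ℝ → Fin nx → ℝ) (z : ℝ → Fin nz → ℝ) (t : ℝ) :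
    Fin nx ⊕ Fin nz → ℝ :=
  Sum.elim (x t) (z t)

/-- The origin is globally exponentially stable: in every norm, all solutions satisfy an
exponential bound with common constants. -/
def OriginGES {nx nz : ℕ} (A : Matrix (Fin nx) (Fin nx) ℝ) (B : Matrix (Fin nx) (Fin nz) ℝ)
    (C : Matrix (Fin nz) (Fin nx) ℝ) (D : Matrix (Fin nz) (Fin nz) ℝ) (n : ℕ) (T : ℝ) : Prop :=
  ∀ N : Seminorm ℝ (Fin nx ⊕ Fin nz → ℝ), IsNorm N →
    ∃ a r : ℝ, 0 < a ∧ 0 ≤ r ∧ ∀ x z, IsSolution A B C D n T x z →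
      ∀ t : ℝ, 0 ≤ t → N (state x z t) ≤ r * Real.exp (-(a * t)) * N (state x z 0)

section Discretization

variable {nx nz : ℕ} (A : Matrix (Fin nx) (Fin nx) ℝ) (B : Matrix (Fin nx) (Fin nz) ℝ)
  (C : Matrix (Fin nz) (Fin nx) ℝ) (D : Matrix (Fin nz) (Fin nz) ℝ)

/-- `∫₀ᵀ e^{A (T - s)} ds`, entry by entry. -/
def expIntegral (T : ℝ) : Matrix (Fin nx) (Fin nx) ℝ :=
  Matrix.of fun i j => ∫ s in (0 : ℝ)..T, NormedSpace.exp ((T - s) • A) i j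

/-- The block matrix `𝓛(n, T)`. -/
def transition (n : ℕ) (T : ℝ) : Matrix (Fin nx ⊕ Fin nz) (Fin nx ⊕ Fin nz) ℝ :=
  Matrix.fromBlocks
    (NormedSpace.exp (T • A))
    (expIntegral A T * B)
    ((1 - D ^ n) * (1 - D)⁻¹ * C * NormedSpace.exp (T • A))
    ((1 - D ^ n) * (1 - D)⁻¹ * C * (expIntegral A T * B) + D ^ n)

end Discretization

/-- Norms on the two state spaces and the constants that enter the bound on the sampling interval.
The Lipschitz constants are those of `f(x, z) = A x + B z` and `G(x, z) = C x + D z`. -/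
structure Gains (nx nz : ℕ) where
  normX : Seminorm ℝ (Fin nx → ℝ)
  normZ : Seminorm ℝ (Fin nz → ℝ)
  lipXf : ℝ
  lipZf : ℝ
  lipXG : ℝ
  lipZG : ℝ
  xi : ℝ
  zeta : ℝ

namespace Gains

variable {nx nz : ℕ}

/-- The constants of `g` are valid for the system with matrices `A`, `B`, `C`, `D`. -/
structure IsValid (g : Gains nx nz) (A : Matrix (Fin nx) (Fin nx) ℝ)
    (B : Matrix (Fin nx) (Fin nz) ℝ) (C : Matrix (Fin nz) (Fin nx) ℝ)
    (D : Matrix (Fin nz) (Fin nz) ℝ) : Prop where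
  isNorm_normX : IsNorm g.normX
  isNorm_normZ : IsNorm g.normZ
  lipXf_bound : opNorm g.normX g.normX A ≤ g.lipXf
  lipZf_bound : opNorm g.normZ g.normX B ≤ g.lipZf
  lipZf_pos : 0 < g.lipZf
  lipXG_bound : opNorm g.normX g.normZ C ≤ g.lipXG
  lipXG_pos : 0 < g.lipXG
  lipZG_bound : opNorm g.normZ g.normZ D ≤ g.lipZG
  lipZG_lt_one : g.lipZG < 1
  xi_bound : LogNormLE g.normX A g.xi
  zeta_pos : 0 < g.zeta
  zeta_bound : LogNormLE g.normX (reducedMatrix A B C D) (-g.zeta)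

/-- The constant `C₁`. -/
def C₁ (g : Gains nx nz) : ℝ :=
  g.lipZf * g.lipXG / (1 - g.lipZG) * (g.lipXf + g.lipZf * g.lipXG / (1 - g.lipZG))

/-- The constant `C₂(n)`. -/
def C₂ (g : Gains nx nz) (n : ℕ) : ℝ :=
  g.lipZG ^ n * (g.lipXG * g.lipZf / (1 - g.lipZG))

/-- The argument of the logarithm in `T(n)`. -/
def logArg (g : Gains nx nz) (n : ℕ) : ℝ :=
  g.xi * (1 - g.lipZG ^ n) / (g.C₂ n + g.C₁ / g.zeta) + 1

open Classical in
/-- The bound `T(n)`. If `xi` is so negative that the argument of the logarithm is not positive,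
then `T(n) = +∞` (the convention `log s = -∞` for `s ≤ 0`). -/
def samplingBound (g : Gains nx nz) (n : ℕ) : EReal :=
  if g.xi = 0 then (((1 - g.lipZG ^ n) / (g.C₂ n + g.C₁ / g.zeta) : ℝ) : EReal)
  else if 0 < g.logArg n then ((1 / g.xi * Real.log (g.logArg n) : ℝ) : EReal)
  else ⊤

end Gains

end SampledLTI

end

/-! Measure the state by `P = ‖x‖` and by `Q = ‖w‖`, where `w = z - (1 - D)⁻¹ C x` is the deviation
of `z` from equilibrium. With `z` frozen, `x` follows the reduced model forced by `B w`, so `ζ`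
gives decay (`normX_flow_le`). Meanwhile `w` changes only because `x` drifts, by at most its initial
velocity times `φ(T) = ∫₀ᵀ e^{ξs} ds`, which is `gronwallBound 0 ξ 1 T` (`normX_flow_sub_le`,
`normZ_sub_flow_le`). At the sampling instant the `n` iterations multiply `w` by `D ^ n`.

So one period acts on `(P, Q)` below a nonnegative 2×2 matrix `m`. With `q = ℓ_D ^ n` one finds `det
(1 - m) = (1 - e^{-ζT}) (1 - q - φ(T) (C₂ n + C₁/ζ))`. Its last factor is positive when `T < T(n)`
(`gronwallBound_mul_lt`), so some weighted norm `P + β Q` is contracted (`exists_weight_of_mul_lt`,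
`exists_transition_contraction`) and the transition matrix is Schur. A norm adapted to its spectral
radius gives the discrete rate, and bounded growth within a period gives the continuous-time bound.

Admissible data come from adapted norms for `D` and for a Schur Euler step `1 + h M` of the reduced
matrix `M`; by convexity the logarithmic norm is at most `(‖1 + h M‖ - 1) / h < 0`. -/

noncomputable section

namespace SampledLTI

/-! ### Equivalence of norms in finite dimension. -/

section FiniteDimensional

variable {ι : Type*} [Fintype ι]

lemma seminorm_le_mul_norm (p : Seminorm ℝ (ι → ℝ)) : ∃ K, 0 < K ∧ ∀ v, p v ≤ K * ‖v‖ := by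
  classical
  refine ⟨∑ i, p (Pi.single i 1) + 1, by positivity, fun v => ?_⟩
  have hv : v = ∑ i, v i • (Pi.single i 1 : ι → ℝ) := by
    ext j; simp [Finset.sum_apply, Pi.single_apply]
  calc p v = p (∑ i, v i • (Pi.single i 1 : ι → ℝ)) := by rw [← hv]
    _ ≤ ∑ i, p (v i • (Pi.single i 1 : ι → ℝ)) := 
        Finset.le_sum_of_subadditive p (map_zero p).le (map_add_le_add p) _ _
    _ ≤ ∑ i, ‖v‖ * p (Pi.single i 1) := by
        gcongr with i
        rw [map_smul_eq_mul]
        gcongr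
        exact norm_le_pi_norm v i
    _ = (∑ i, p (Pi.single i 1)) * ‖v‖ := by rw [← Finset.mul_sum, mul_comm]
    _ ≤ _ := by gcongr; linarith

lemma continuous_seminorm (p : Seminorm ℝ (ι → ℝ)) : Continuous p := by
  obtain ⟨K, hK, h⟩ := seminorm_le_mul_norm p
  refine (LipschitzWith.of_dist_le_mul (K := ⟨K, hK.le⟩) fun v w => ?_).continuous
  rw [Real.dist_eq, dist_eq_norm]
  exact (abs_sub_map_le_sub p v w).trans (h _)

lemma IsNorm.norm_le_mul {p : Seminorm ℝ (ι → ℝ)} (hp : IsNorm p) :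
    ∃ K, 0 < K ∧ ∀ v, ‖v‖ ≤ K * p v := by
  -- The sphere is empty only in the trivial space; otherwise the constant is the inverse of the
  -- minimum of `p` on it.
  rcases (Metric.sphere (0 : ι → ℝ) 1).eq_empty_or_nonempty with he | hne
  · refine ⟨1, one_pos, fun v => ?_⟩
    have : v = 0 := by
      by_contra hv
      have : ‖v‖⁻¹ • v ∈ Metric.sphere (0 : ι → ℝ) 1 := by
        simp [norm_smul, norm_ne_zero_iff.2 hv]
      simp [he] at this
    simp [this]
  obtain ⟨w, hw, hmin⟩ := (isCompact_sphere (0 : ι → ℝ) 1).exists_isMinOn hne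
    (continuous_seminorm p).continuousOn
  have hw0 : w ≠ 0 := by rintro rfl; simp at hw
  have hpw : 0 < p w := lt_of_le_of_ne (apply_nonneg p w) fun h => hw0 (hp w h.symm)
  refine ⟨(p w)⁻¹, inv_pos.2 hpw, fun v => ?_⟩
  rcases eq_or_ne v 0 with rfl | hv
  · simp
  have hv' : 0 < ‖v‖ := norm_pos_iff.2 hv
  have hm : ‖v‖⁻¹ • v ∈ Metric.sphere (0 : ι → ℝ) 1 := by
    simp [norm_smul, hv'.ne']
  have := isMinOn_iff.1 hmin _ hm
  rw [map_smul_eq_mul, norm_inv, norm_norm, inv_mul_eq_div, le_div_iff₀ hv'] at this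
  rw [inv_mul_eq_div, le_div_iff₀ hpw]
  linarith

lemma IsNorm.seminorm_le_mul {p : Seminorm ℝ (ι → ℝ)} (hp : IsNorm p) (q : Seminorm ℝ (ι → ℝ)) :
    ∃ K, 0 < K ∧ ∀ v, q v ≤ K * p v := by
  obtain ⟨K, hK, h⟩ := hp.norm_le_mul
  obtain ⟨L, hL, h'⟩ := seminorm_le_mul_norm q
  refine ⟨L * K, by positivity, fun v => (h' v).trans ?_⟩
  rw [mul_assoc]
  gcongr
  exact h v

end FiniteDimensional

/-! ### Induced norms and existence of logarithmic norms. -/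

section OpNorm

variable {k m : ℕ} {p : Seminorm ℝ (Fin k → ℝ)} {q : Seminorm ℝ (Fin m → ℝ)}

lemma opNorm_nonneg (M : Matrix (Fin m) (Fin k) ℝ) : 0 ≤ opNorm p q M :=
  Real.sSup_nonneg (by rintro _ ⟨v, -, rfl⟩; exact apply_nonneg q _)

lemma opNorm_le {M : Matrix (Fin m) (Fin k) ℝ} {c : ℝ} (hc : 0 ≤ c)
    (h : ∀ v, q (M *ᵥ v) ≤ c * p v) : opNorm p q M ≤ c :=
  Real.sSup_le (by rintro _ ⟨v, hv, rfl⟩; simpa [hv] using h v) hc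

lemma IsNorm.exists_mulVec_le (hp : IsNorm p) (q : Seminorm ℝ (Fin m → ℝ))
    (M : Matrix (Fin m) (Fin k) ℝ) :
    ∃ K, 0 < K ∧ ∀ v, q (M *ᵥ v) ≤ K * p v :=
  hp.seminorm_le_mul (q.comp M.mulVecLin)

lemma IsNorm.le_opNorm (hp : IsNorm p) (q : Seminorm ℝ (Fin m → ℝ))
    (M : Matrix (Fin m) (Fin k) ℝ) (v : Fin k → ℝ) :
    q (M *ᵥ v) ≤ opNorm p q M * p v := by
  obtain ⟨K, hK, h⟩ := hp.exists_mulVec_le q M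
  rcases (apply_nonneg p v).eq_or_lt with h0 | h0
  · simp [hp v h0.symm]
  have hb : BddAbove {r : ℝ | ∃ v, p v = 1 ∧ r = q (M *ᵥ v)} :=
    ⟨K, by rintro _ ⟨v, hv, rfl⟩; simpa [hv] using h v⟩
  have := le_csSup hb ⟨(p v)⁻¹ • v, by
    rw [map_smul_eq_mul, Real.norm_of_nonneg (by positivity), inv_mul_cancel₀ h0.ne'], rfl⟩
  rw [Matrix.mulVec_smul, map_smul_eq_mul, Real.norm_of_nonneg (by positivity), inv_mul_eq_div,
    div_le_iff₀ h0] at this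
  exact this

lemma IsNorm.mulVec_le_of_opNorm_le (hp : IsNorm p) {M : Matrix (Fin m) (Fin k) ℝ} {c : ℝ}
    (h : opNorm p q M ≤ c) (v : Fin k → ℝ) : q (M *ᵥ v) ≤ c * p v :=
  (hp.le_opNorm q M v).trans (by gcongr)

lemma IsNorm.opNorm_one (hp : IsNorm p) (hk : 0 < k) : opNorm p p 1 = 1 := by
  refine le_antisymm (opNorm_le zero_le_one fun v => by simp) ?_
  let e : Fin k → ℝ := Pi.single ⟨0, hk⟩ 1
  have he : e ≠ 0 := by simp [e]
  have h0 : 0 < p e := lt_of_le_of_ne (apply_nonneg p e) fun h => he (hp e h.symm)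
  have := hp.le_opNorm p 1 e
  rw [Matrix.one_mulVec] at this
  exact le_of_mul_le_mul_right (by linarith) h0

lemma IsNorm.convexOn_opNorm (hp : IsNorm p) (M : Matrix (Fin k) (Fin k) ℝ) :
    ConvexOn ℝ Set.univ fun h : ℝ => opNorm p p (1 + h • M) := by
  refine ⟨convex_univ, fun s _ t _ a b ha hb hab => ?_⟩
  simp only [smul_eq_mul]
  have h1 := opNorm_nonneg (p := p) (q := p) (1 + s • M)
  have h2 := opNorm_nonneg (p := p) (q := p) (1 + t • M)
  refine opNorm_le (by positivity) fun v => ?_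
  have hM : (1 + (a * s + b * t) • M) *ᵥ v
      = a • ((1 + s • M) *ᵥ v) + b • ((1 + t • M) *ᵥ v) := by
    simp only [Matrix.add_mulVec, Matrix.one_mulVec, Matrix.smul_mulVec]
    ext i
    simp only [Pi.add_apply, Pi.smul_apply, smul_eq_mul]
    linear_combination -(v i) * hab
  rw [hM]
  refine (map_add_le_add p _ _).trans ?_
  rw [map_smul_eq_mul, map_smul_eq_mul, Real.norm_of_nonneg ha, Real.norm_of_nonneg hb]
  have h3 := mul_le_mul_of_nonneg_left (hp.le_opNorm p (1 + s • M) v) ha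
  have h4 := mul_le_mul_of_nonneg_left (hp.le_opNorm p (1 + t • M) v) hb
  linarith

/-- A convex function of `h` has a right derivative at `0`, bounded above by every secant slope to
the right. Positive dimension ensures that the value at `0` is `1`. -/
lemma IsNorm.exists_hasLogNorm (hp : IsNorm p) (hk : 0 < k) (M : Matrix (Fin k) (Fin k) ℝ) :
    ∃ m, HasLogNorm p M m ∧ ∀ h, 0 < h → m ≤ (opNorm p p (1 + h • M) - 1) / h := by
  have hc := hp.convexOn_opNorm M
  have hslope : ∀ h, slope (fun h : ℝ => opNorm p p (1 + h • M)) 0 h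
      = (opNorm p p (1 + h • M) - 1) / h := by
    intro h
    simp [slope_def_field, hp.opNorm_one hk]
  have hd := hc.hasDerivWithinAt_rightDeriv_of_mem_interior (x := 0) (by simp)
  refine ⟨derivWithin (fun h : ℝ => opNorm p p (1 + h • M)) (Set.Ioi 0) 0, ?_, fun h hh => ?_⟩
  · have := (hasDerivWithinAt_iff_tendsto_slope' Set.self_notMem_Ioi).1 hd
    exact this.congr hslope
  · rw [← hslope]
    exact hc.le_slope_of_hasDerivWithinAt_Ioi (Set.mem_univ _) (Set.mem_univ _) hh hd

lemma IsNorm.exists_logNormLE (hp : IsNorm p) (hk : 0 < k) (M : Matrix (Fin k) (Fin k) ℝ) :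
    ∃ c, LogNormLE p M c := by
  obtain ⟨m, hm, -⟩ := hp.exists_hasLogNorm hk M
  exact ⟨m, m, hm, le_rfl⟩

end OpNorm

/-! ### Grönwall's inequality with a logarithmic norm. -/

section Gronwall

variable {k : ℕ} {p : Seminorm ℝ (Fin k → ℝ)}

/-- Growth estimate for a linear differential inequality governed by a logarithmic norm. -/
lemma LogNormLE.le_gronwallBound (hp : IsNorm p) {M : Matrix (Fin k) (Fin k) ℝ} {c : ℝ}
    (hM : LogNormLE p M c) {x u : ℝ → Fin k → ℝ} {a b ε : ℝ}
    (hx : ContinuousOn x (Set.Icc a b))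
    (hx' : ∀ t ∈ Set.Ico a b, HasDerivWithinAt x (M *ᵥ x t + u t) (Set.Ioi t) t)
    (hu : ∀ t ∈ Set.Ico a b, p (u t) ≤ ε) :
    ∀ t ∈ Set.Icc a b, p (x t) ≤ gronwallBound (p (x a)) c ε (t - a) := by
  obtain ⟨m, hm, hmc⟩ := hM
  obtain ⟨K, hK, hpK⟩ := seminorm_le_mul_norm p
  -- `p ∘ x` need not be differentiable; an upper bound on its right difference quotients suffices.
  refine le_gronwallBound_of_liminf_deriv_right_le (f' := fun t => m * p (x t) + ε)
    ((continuous_seminorm p).comp_continuousOn hx) (fun t ht r hr => ?_) le_rfl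
    (fun t _ => by gcongr)
  apply Filter.Eventually.frequently
  have hsub : Filter.Tendsto (fun s : ℝ => s - t) (𝓝[>] t) (𝓝[>] 0) := by
    refine tendsto_nhdsWithin_iff.2 ⟨?_, ?_⟩
    · have : Filter.Tendsto (fun s : ℝ => s - t) (𝓝 t) (𝓝 (t - t)) :=
        (continuous_id.sub continuous_const).tendsto t
      rw [sub_self] at this
      exact this.mono_left nhdsWithin_le_nhds
    · filter_upwards [self_mem_nhdsWithin] with s hs
      simpa using hs
  have h1 := ((hm.comp hsub).mul_const (p (x t))).add_const ε
  have h2 := (hasDerivWithinAt_iff_tendsto_slope' Set.self_notMem_Ioi).1 (hx' t ht)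
  have h3 : Filter.Tendsto (fun s => K * ‖slope x t s - (M *ᵥ x t + u t)‖) (𝓝[>] t) (𝓝 0) := by
    have := (h2.sub_const (M *ᵥ x t + u t)).norm.const_mul K
    simpa using this
  have h4 := h1.add h3
  rw [add_zero] at h4
  filter_upwards [h4.eventually_lt_const hr, self_mem_nhdsWithin] with s hs hts
  refine lt_of_le_of_lt ?_ hs
  have hpos : 0 < s - t := sub_pos.2 hts
  set d := slope x t s - (M *ᵥ x t + u t) with hd
  -- An exact Euler step whose defect `d` tends to zero; the norm of its first factor produces the
  -- logarithmic norm in the limit.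
  have hxs : x s = (1 + (s - t) • M) *ᵥ x t + (s - t) • u t + (s - t) • d := by
    rw [hd, slope_def_module, Matrix.add_mulVec, Matrix.one_mulVec, Matrix.smul_mulVec]
    simp only [smul_sub, smul_add, smul_smul, mul_inv_cancel₀ hpos.ne', one_smul]
    abel
  have h5 : p (x s) ≤ opNorm p p (1 + (s - t) • M) * p (x t) + (s - t) * ε
      + (s - t) * (K * ‖d‖) := by
    rw [hxs]
    refine (map_add_le_add p _ _).trans (add_le_add ((map_add_le_add p _ _).trans
      (add_le_add (hp.le_opNorm p _ _) ?_)) ?_)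
    · rw [map_smul_eq_mul, Real.norm_of_nonneg hpos.le]
      gcongr
      exact hu t ht
    · rw [map_smul_eq_mul, Real.norm_of_nonneg hpos.le]
      gcongr
      exact hpK d
  rw [inv_mul_eq_div, div_le_iff₀ hpos]
  simp only [Function.comp_apply]
  have h6 : ((opNorm p p (1 + (s - t) • M) - 1) / (s - t) * p (x t) + ε + K * ‖d‖) * (s - t)
      = (opNorm p p (1 + (s - t) • M) - 1) * p (x t) + (s - t) * ε + (s - t) * (K * ‖d‖) := by
    field_simp
  rw [h6]
  linarith

end Gronwall

lemma seminorm_sum_apply {E κ : Type*} [AddCommGroup E] [Module ℝ E] (s : Finset κ)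
    (p : κ → Seminorm ℝ E) (v : E) : (∑ j ∈ s, p j) v = ∑ j ∈ s, p j v := by
  classical
  induction s using Finset.induction_on with
  | empty => simp
  | insert a s ha ih => rw [Finset.sum_insert ha, Finset.sum_insert ha, add_apply, ih]

/-! ### Spectral radius, adapted norms and Euler steps. -/

section Spectral

attribute [local instance] Matrix.linftyOpNormedRing Matrix.linftyOpNormedAlgebra

variable {ι : Type*} [Fintype ι] [DecidableEq ι]

lemma exists_eigenvector_of_mem_spectrum {M : Matrix ι ι ℂ} {l : ℂ} (hl : l ∈ spectrum ℂ M) :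
    ∃ v, v ≠ 0 ∧ M *ᵥ v = l • v := by
  rw [spectrum.mem_iff, Matrix.isUnit_iff_isUnit_det, isUnit_iff_ne_zero, not_not] at hl
  obtain ⟨v, hv, h⟩ := Matrix.exists_mulVec_eq_zero_iff.2 hl
  refine ⟨v, hv, ?_⟩
  rw [Matrix.sub_mulVec, sub_eq_zero, Algebra.algebraMap_eq_smul_one, Matrix.smul_mulVec,
    Matrix.one_mulVec] at h
  exact h.symm

lemma mem_spectrum_of_eigenvector {M : Matrix ι ι ℂ} {l : ℂ} {v : ι → ℂ} (hv : v ≠ 0)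
    (h : M *ᵥ v = l • v) : l ∈ spectrum ℂ M := by
  rw [spectrum.mem_iff, Matrix.isUnit_iff_isUnit_det, isUnit_iff_ne_zero, not_not]
  refine Matrix.exists_mulVec_eq_zero_iff.1 ⟨v, hv, ?_⟩
  rw [Matrix.sub_mulVec, sub_eq_zero, Algebra.algebraMap_eq_smul_one, Matrix.smul_mulVec,
    Matrix.one_mulVec, h]

lemma isSchur_of_forall_lt [Nonempty ι] {M : Matrix ι ι ℝ}
    (h : ∀ l ∈ spectrum ℂ (M.map (algebraMap ℝ ℂ)), ‖l‖ < 1) : IsSchur M := by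
  have := spectrum.spectralRadius_lt_of_forall_lt (M.map (algebraMap ℝ ℂ)) (r := 1)
    fun l hl => by simpa [← NNReal.coe_lt_coe] using h l hl
  simpa [IsSchur] using this

lemma specRad_nonneg (M : Matrix ι ι ℝ) : 0 ≤ specRad M := ENNReal.toReal_nonneg

lemma IsSchur.specRad_lt_one {M : Matrix ι ι ℝ} (h : IsSchur M) : specRad M < 1 := by
  have := (ENNReal.toReal_lt_toReal (lt_top_of_lt h).ne ENNReal.one_ne_top).2 h
  simpa [specRad] using this

lemma norm_mulVec_le_map (M : Matrix ι ι ℝ) (v : ι → ℝ) :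
    ‖M *ᵥ v‖ ≤ ‖M.map (algebraMap ℝ ℂ)‖ * ‖v‖ := by
  have h : ∀ w : ι → ℝ, ‖(fun i => (w i : ℂ))‖ = ‖w‖ := fun w => by
    simp [Pi.norm_def]
  have h2 : M.map (algebraMap ℝ ℂ) *ᵥ (fun i => (v i : ℂ)) = fun i => ((M *ᵥ v) i : ℂ) := by
    ext i
    simp [Matrix.mulVec, dotProduct]
  have := Matrix.linfty_opNorm_mulVec (M.map (algebraMap ℝ ℂ)) (fun i => (v i : ℂ))
  rwa [h2, h, h] at this

/-- A matrix contracts some norm at any rate above its spectral radius. -/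
lemma exists_isNorm_mulVec_le (M : Matrix ι ι ℝ) {r : ℝ} (hr : 0 < r)
    (h : spectralRadius ℂ (M.map (algebraMap ℝ ℂ)) < ENNReal.ofReal r) :
    ∃ N : Seminorm ℝ (ι → ℝ), IsNorm N ∧ ∀ v, N (M *ᵥ v) ≤ r * N v := by
  -- Gelfand's formula supplies one exponent `m > 0` with `‖M ^ m‖ ≤ r ^ m`.
  have hG := spectrum.pow_norm_pow_one_div_tendsto_nhds_spectralRadius (M.map (algebraMap ℝ ℂ))
  obtain ⟨m, hm, hm0⟩ := ((hG.eventually_lt_const h).and (Filter.eventually_gt_atTop 0)).exists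
  have hpow : ‖(M ^ m).map (algebraMap ℝ ℂ)‖ ≤ r ^ m := by
    have h1 := (ENNReal.ofReal_lt_ofReal_iff hr).1 hm
    have h2 : (M ^ m).map (algebraMap ℝ ℂ) = (M.map (algebraMap ℝ ℂ)) ^ m :=
      map_pow (algebraMap ℝ ℂ).mapMatrix M m
    rw [h2]
    have h3 := pow_le_pow_left₀ (by positivity) h1.le m
    rwa [← Real.rpow_natCast (_ ^ _), ← Real.rpow_mul (norm_nonneg _), one_div,
      inv_mul_cancel₀ (by positivity), Real.rpow_one] at h3
  let c : ℕ → NNReal := fun j => ⟨(r ^ j)⁻¹, by positivity⟩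
  let N : Seminorm ℝ (ι → ℝ) := ∑ j ∈ Finset.range m, c j • (normSeminorm ℝ (ι → ℝ)).comp (M ^ j).mulVecLin
  have hN : ∀ v, N v = ∑ j ∈ Finset.range m, (r ^ j)⁻¹ * ‖M ^ j *ᵥ v‖ := fun v => by
    simp only [N]
    rw [seminorm_sum_apply]
    rfl
  obtain ⟨m, rfl⟩ : ∃ j, m = j + 1 := ⟨m - 1, by omega⟩
  refine ⟨N, fun v hv => ?_, fun v => ?_⟩
  · rw [hN, Finset.sum_eq_zero_iff_of_nonneg (fun j _ => by positivity)] at hv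
    simpa using hv 0 (by simp)
  · rw [hN, hN, Finset.sum_range_succ, Finset.sum_range_succ' _ m, mul_add, Finset.mul_sum]
    simp only [Matrix.mulVec_mulVec, ← pow_succ]
    -- Applying `M` shifts each term of `∑ r⁻ʲ ‖Mʲ v‖` to `r` times the next; the top term is
    -- returned to `r ‖v‖` by `hpow`.
    refine add_le_add (Finset.sum_le_sum fun j _ => le_of_eq ?_) ?_
    · rw [pow_succ r]
      field_simp
    · have := (norm_mulVec_le_map (M ^ (m + 1)) v).trans
        (mul_le_mul_of_nonneg_right hpow (norm_nonneg v))
      rw [inv_mul_le_iff₀ (by positivity)]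
      calc _ ≤ _ := this
        _ = _ := by simp; ring

lemma IsSchur.exists_isNorm_mulVec_le {M : Matrix ι ι ℝ} (h : IsSchur M) :
    ∃ N : Seminorm ℝ (ι → ℝ), IsNorm N ∧ ∀ v, N (M *ᵥ v) ≤ (1 + specRad M) / 2 * N v := by
  have h0 := specRad_nonneg M
  have h1 := h.specRad_lt_one
  refine SampledLTI.exists_isNorm_mulVec_le M (by linarith) ?_
  rw [ENNReal.lt_ofReal_iff_toReal_lt (lt_top_of_lt h).ne]
  change specRad M < _
  linarith

/-- A matrix that contracts some norm is Schur. -/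
lemma isSchur_of_mulVec_le [Nonempty ι] {M : Matrix ι ι ℝ} {N : Seminorm ℝ (ι → ℝ)}
    (hN : IsNorm N) {c : ℝ} (hc : 0 ≤ c) (hc1 : c < 1) (h : ∀ v, N (M *ᵥ v) ≤ c * N v) :
    IsSchur M := by
  refine isSchur_of_forall_lt fun l hl => ?_
  obtain ⟨v, hv, hMv⟩ := exists_eigenvector_of_mem_spectrum hl
  obtain ⟨K, hK, hKN⟩ := hN.norm_le_mul
  have hpow : ∀ (w : ι → ℝ) (j : ℕ), N (M ^ j *ᵥ w) ≤ c ^ j * N w := by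
    intro w j
    induction j with
    | zero => simp
    | succ j ih =>
      rw [pow_succ', ← Matrix.mulVec_mulVec, pow_succ', mul_assoc]
      exact (h _).trans (by gcongr)
  have hlim : ∀ (w : ι → ℝ) (i : ι),
      Filter.Tendsto (fun j : ℕ => (M ^ j *ᵥ w) i) Filter.atTop (𝓝 0) := by
    intro w i
    refine squeeze_zero_norm (a := fun j => K * (c ^ j * N w)) (fun j => ?_) ?_
    · exact (norm_le_pi_norm _ i).trans ((hKN _).trans (by gcongr; exact hpow w j))
    · simpa using ((tendsto_pow_atTop_nhds_zero_of_lt_one hc hc1).mul_const (N w)).const_mul K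
  obtain ⟨i, hi⟩ := Function.ne_iff.1 hv
  have hpowv : ∀ j : ℕ, (M.map (algebraMap ℝ ℂ)) ^ j *ᵥ v = l ^ j • v := by
    intro j
    induction j with
    | zero => simp
    | succ j ih =>
      rw [pow_succ', ← Matrix.mulVec_mulVec, ih, Matrix.mulVec_smul, hMv, smul_smul, pow_succ]
  -- The contraction is known only on real vectors, so it is applied to the real and imaginary parts
  -- of the eigenvector.
  have hsplit : ∀ j : ℕ, l ^ j * v i = ((M ^ j *ᵥ fun i => (v i).re) i : ℂ)
      + ((M ^ j *ᵥ fun i => (v i).im) i : ℂ) * Complex.I := by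
    intro j
    have h2 : (M ^ j).map (algebraMap ℝ ℂ) = (M.map (algebraMap ℝ ℂ)) ^ j :=
      map_pow (algebraMap ℝ ℂ).mapMatrix M j
    have := congrFun (hpowv j) i
    rw [← h2] at this
    rw [Pi.smul_apply, smul_eq_mul] at this
    rw [← this]
    simp only [Matrix.mulVec, dotProduct, Matrix.map_apply, Complex.coe_algebraMap,
      Complex.ofReal_sum, Complex.ofReal_mul, Finset.sum_mul, ← Finset.sum_add_distrib]
    refine Finset.sum_congr rfl fun a _ => ?_
    conv_lhs => rw [← Complex.re_add_im (v a)]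
    ring
  have hz : Filter.Tendsto (fun j : ℕ => l ^ j * v i) Filter.atTop (𝓝 0) := by
    simp only [hsplit]
    have e1 := (Complex.continuous_ofReal.tendsto 0).comp (hlim (fun i => (v i).re) i)
    have e2 := (Complex.continuous_ofReal.tendsto 0).comp (hlim (fun i => (v i).im) i)
    simpa using e1.add (e2.mul_const Complex.I)
  have hz' : Filter.Tendsto (fun j : ℕ => ‖l‖ ^ j) Filter.atTop (𝓝 0) := by
    have := (hz.mul_const (v i)⁻¹).norm
    simpa [mul_assoc, mul_inv_cancel₀ hi] using this
  simpa using tendsto_pow_atTop_nhds_zero_iff.1 hz'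

/-- A Hurwitz matrix has a Schur Euler step. -/
lemma IsHurwitz.exists_isSchur_one_add_smul [Nonempty ι] {M : Matrix ι ι ℝ} (hM : IsHurwitz M) :
    ∃ h : ℝ, 0 < h ∧ IsSchur (1 + h • M) := by
  set σ := spectrum ℂ (M.map (algebraMap ℝ ℂ))
  have hcpt : IsCompact σ := spectrum.isCompact _
  have hne : σ.Nonempty := spectrum.nonempty _
  obtain ⟨l₀, hl₀, hmax⟩ := hcpt.exists_isMaxOn hne Complex.continuous_re.continuousOn
  obtain ⟨R, hR⟩ := hcpt.isBounded.exists_norm_le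
  have hd : 0 < -l₀.re := neg_pos.2 (hM l₀ hl₀)
  set d := -l₀.re with hd'
  have hK : 0 < R ^ 2 + 1 := by positivity
  -- If `Re w ≤ -d` and `‖w‖ ≤ R`, this step size `h` gives `‖1 + h w‖² ≤ 1 - 2hd + h²R² = 1 - hd -
  -- h² < 1`.
  refine ⟨d / (R ^ 2 + 1), by positivity, isSchur_of_forall_lt fun l hl => ?_⟩
  set h := d / (R ^ 2 + 1) with hh
  have h0 : 0 < h := by positivity
  obtain ⟨v, hv, hMv⟩ := exists_eigenvector_of_mem_spectrum hl
  have hmap : (1 + h • M).map (algebraMap ℝ ℂ) = 1 + (h : ℂ) • M.map (algebraMap ℝ ℂ) := by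
    ext i j
    by_cases hij : i = j <;> simp [hij]
  rw [hmap, Matrix.add_mulVec, Matrix.one_mulVec, Matrix.smul_mulVec] at hMv
  have hh0 : (h : ℂ) ≠ 0 := by exact_mod_cast h0.ne'
  have hmem : (l - 1) / h ∈ σ := by
    refine mem_spectrum_of_eigenvector hv ?_
    have : (h : ℂ) • M.map (algebraMap ℝ ℂ) *ᵥ v = (l - 1) • v := by
      rw [sub_smul, one_smul, ← hMv]
      abel
    rw [div_eq_inv_mul, ← smul_smul, ← this, smul_smul, inv_mul_cancel₀ hh0, one_smul]
  set w := (l - 1) / h with hw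
  have hlw : l = 1 + h * w := by rw [hw]; field_simp; ring
  have hre : w.re ≤ -d := by
    have := isMaxOn_iff.1 hmax w hmem
    simpa [hd'] using this
  have hwR : ‖w‖ ^ 2 ≤ R ^ 2 := pow_le_pow_left₀ (norm_nonneg _) (hR w hmem) 2
  have hnl : ‖l‖ ^ 2 = 1 + 2 * h * w.re + h ^ 2 * ‖w‖ ^ 2 := by
    rw [hlw, Complex.sq_norm, Complex.sq_norm, Complex.normSq_apply, Complex.normSq_apply]
    simp
    ring
  have hhd : h * (R ^ 2 + 1) = d := by rw [hh]; field_simp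
  have : ‖l‖ ^ 2 < 1 := by
    rw [hnl]
    have e1 : h * w.re ≤ h * (-d) := by gcongr
    have e2 : h ^ 2 * ‖w‖ ^ 2 ≤ h ^ 2 * R ^ 2 := by gcongr
    have e3 : h ^ 2 * R ^ 2 = h * d - h ^ 2 := by rw [← hhd]; ring
    nlinarith [mul_pos h0 hd, sq_nonneg h]
  exact (sq_lt_one_iff₀ (norm_nonneg _)).1 this

end Spectral

/-! ### Existence of admissible data. -/

section Existence

variable {nx nz : ℕ} {A : Matrix (Fin nx) (Fin nx) ℝ} {B : Matrix (Fin nx) (Fin nz) ℝ}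
  {C : Matrix (Fin nz) (Fin nx) ℝ} {D : Matrix (Fin nz) (Fin nz) ℝ}

lemma exists_gains_isValid (hnx : 0 < nx) (hRM : IsHurwitz (reducedMatrix A B C D))
    (hD : IsSchur D) : ∃ g : Gains nx nz, g.IsValid A B C D := by
  have : Nonempty (Fin nx) := ⟨⟨0, hnx⟩⟩
  obtain ⟨q, hq, hqD⟩ := hD.exists_isNorm_mulVec_le
  obtain ⟨h, h0, hS⟩ := hRM.exists_isSchur_one_add_smul
  obtain ⟨p, hp, hpM⟩ := hS.exists_isNorm_mulVec_le
  have hD0 := specRad_nonneg D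
  have hD1 := hD.specRad_lt_one
  have hS0 := specRad_nonneg (1 + h • reducedMatrix A B C D)
  have hS1 := hS.specRad_lt_one
  obtain ⟨ξ, hξ⟩ := hp.exists_logNormLE hnx A
  obtain ⟨m, hm, hmle⟩ := hp.exists_hasLogNorm hnx (reducedMatrix A B C D)
  have hm0 : m < 0 := by
    refine (hmle h h0).trans_lt (div_neg_of_neg_of_pos ?_ h0)
    have := opNorm_le (by linarith) hpM
    linarith
  -- The maxima with `1` keep these two constants positive even when `B` or `C` vanishes.
  exact ⟨⟨p, q, opNorm p p A, max (opNorm q p B) 1, max (opNorm p q C) 1, (1 + specRad D) / 2, ξ,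
    -m⟩, hp, hq, le_rfl, le_max_left _ _, lt_max_of_lt_right one_pos, le_max_left _ _,
    lt_max_of_lt_right one_pos, opNorm_le (by linarith) hqD, by dsimp only; linarith, hξ,
    neg_pos.2 hm0, m, hm, by simp⟩

end Existence

/-! ### Variation of constants and uniqueness. -/

section Flow

variable {nx nz : ℕ} (A : Matrix (Fin nx) (Fin nx) ℝ) (B : Matrix (Fin nx) (Fin nz) ℝ)

section
attribute [local instance] Matrix.linftyOpNormedRing Matrix.linftyOpNormedAlgebra

lemma hasDerivAt_exp_smul_apply (t : ℝ) (i j : Fin nx) :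
    HasDerivAt (fun t : ℝ => NormedSpace.exp (t • A) i j)
      ((A * NormedSpace.exp (t • A)) i j) t := by
  have h := hasDerivAt_exp_smul_const' (𝕂 := ℝ) A t
  exact ((Matrix.entryLinearMap ℝ ℝ i j).toContinuousLinearMap.hasFDerivAt.comp_hasDerivAt t h)

end

lemma continuous_exp_smul_apply (i j : Fin nx) :
    Continuous fun t : ℝ => NormedSpace.exp (t • A) i j :=
  continuous_iff_continuousAt.2 fun t => (hasDerivAt_exp_smul_apply A t i j).continuousAt

lemma expIntegral_apply (t : ℝ) (i j : Fin nx) :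
    expIntegral A t i j = ∫ s in (0 : ℝ)..t, NormedSpace.exp (s • A) i j := by
  have := intervalIntegral.integral_comp_sub_left (a := 0) (b := t)
    (fun s => NormedSpace.exp (s • A) i j) t
  simpa [expIntegral] using this

lemma hasDerivAt_expIntegral_apply (t : ℝ) (i j : Fin nx) :
    HasDerivAt (fun t => expIntegral A t i j) (NormedSpace.exp (t • A) i j) t := by
  simp only [expIntegral_apply]
  exact (continuous_exp_smul_apply A i j).integral_hasStrictDerivAt 0 t |>.hasDerivAt

lemma expIntegral_zero : expIntegral A 0 = 0 := by
  ext i j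
  simp [expIntegral]

/-- Both sides have derivative `A e^{tA}` and agree at `0`, so `A` need not be invertible. -/
lemma mul_expIntegral_add_one (t : ℝ) : A * expIntegral A t + 1 = NormedSpace.exp (t • A) := by
  ext i j
  have hd : ∀ t : ℝ, HasDerivAt
      (fun t => (A * expIntegral A t + 1) i j - NormedSpace.exp (t • A) i j) 0 t := by
    intro t
    simp only [Matrix.add_apply, Matrix.mul_apply]
    have h1 := HasDerivAt.fun_sum (u := Finset.univ) fun l _ =>
      (hasDerivAt_expIntegral_apply A t l j).const_mul (A i l)
    have h2 := (h1.add_const ((1 : Matrix (Fin nx) (Fin nx) ℝ) i j)).sub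
      (hasDerivAt_exp_smul_apply A t i j)
    rwa [Matrix.mul_apply, sub_self] at h2
  have := is_const_of_deriv_eq_zero (fun t => (hd t).differentiableAt) (fun t => (hd t).deriv) t 0
  simp only [expIntegral_zero, mul_zero, zero_add, zero_smul, NormedSpace.exp_zero, sub_self]
    at this
  linarith

/-- Solution at time `t` of `ẋ = A x + B z`, `x(0) = x₀`, with constant input `z`. -/
def flow (x₀ : Fin nx → ℝ) (z : Fin nz → ℝ) (t : ℝ) : Fin nx → ℝ :=
  NormedSpace.exp (t • A) *ᵥ x₀ + expIntegral A t *ᵥ (B *ᵥ z)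

lemma flow_zero (x₀ : Fin nx → ℝ) (z : Fin nz → ℝ) : flow A B x₀ z 0 = x₀ := by
  simp [flow, expIntegral_zero]

lemma hasDerivAt_flow (x₀ : Fin nx → ℝ) (z : Fin nz → ℝ) (t : ℝ) :
    HasDerivAt (flow A B x₀ z) (A *ᵥ flow A B x₀ z t + B *ᵥ z) t := by
  have h : A *ᵥ flow A B x₀ z t + B *ᵥ z
      = (A * NormedSpace.exp (t • A)) *ᵥ x₀ + NormedSpace.exp (t • A) *ᵥ (B *ᵥ z) := by
    have e : NormedSpace.exp (t • A) *ᵥ (B *ᵥ z) = A *ᵥ (expIntegral A t *ᵥ (B *ᵥ z)) + B *ᵥ z := by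
      rw [← mul_expIntegral_add_one, Matrix.add_mulVec, Matrix.one_mulVec, ← Matrix.mulVec_mulVec]
    rw [e, flow, Matrix.mulVec_add, ← Matrix.mulVec_mulVec, add_assoc]
  rw [h, hasDerivAt_pi]
  intro i
  have h1 := HasDerivAt.fun_sum (u := Finset.univ) fun j _ =>
    (hasDerivAt_exp_smul_apply A t i j).mul_const (x₀ j)
  have h2 := HasDerivAt.fun_sum (u := Finset.univ) fun j _ =>
    (hasDerivAt_expIntegral_apply A t i j).mul_const ((B *ᵥ z) j)
  exact h1.add h2

/-- The flow is the only solution, among those continuous up to the initial time. -/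
lemma eq_flow {p : Seminorm ℝ (Fin nx → ℝ)} (hp : IsNorm p) {c : ℝ} (hA : LogNormLE p A c)
    {x : ℝ → Fin nx → ℝ} {z : Fin nz → ℝ} {a b : ℝ} (hab : a < b)
    (hx : ContinuousOn x (Set.Icc a b))
    (hx' : ∀ t ∈ Set.Ioo a b, HasDerivAt x (A *ᵥ x t + B *ᵥ z) t) :
    ∀ t ∈ Set.Icc a b, x t = flow A B (x a) z (t - a) := by
  have hr : ∀ t ∈ Set.Ico a b, HasDerivWithinAt x (A *ᵥ x t + B *ᵥ z) (Set.Ioi t) t := by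
    rintro t ⟨hat, htb⟩
    rcases hat.eq_or_lt with rfl | hat
    -- The equation is not assumed at the left endpoint: continuity of `x` makes the derivative
    -- converge there, which yields the right derivative.
    · refine (hasDerivWithinAt_Ici_of_tendsto_deriv (s := Set.Ioo a b)
        (fun s hs => (hx' s hs).differentiableAt.differentiableWithinAt)
        ((hx a ⟨le_rfl, hab.le⟩).mono Set.Ioo_subset_Icc_self) (Ioo_mem_nhdsGT hab) ?_).mono
        Set.Ioi_subset_Ici_self
      have hc : ContinuousWithinAt (fun t => A *ᵥ x t + B *ᵥ z) (Set.Ioo a b) a :=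
        (((Continuous.matrix_mulVec continuous_const continuous_id).continuousAt
          (x := x a)).comp_continuousWithinAt
          ((hx a ⟨le_rfl, hab.le⟩).mono Set.Ioo_subset_Icc_self)).add continuousWithinAt_const
      have hc' : Filter.Tendsto (fun t => A *ᵥ x t + B *ᵥ z) (𝓝[>] a) (𝓝 (A *ᵥ x a + B *ᵥ z)) := by
        rw [← nhdsWithin_Ioo_eq_nhdsGT hab]
        exact hc
      refine hc'.congr' ?_
      filter_upwards [Ioo_mem_nhdsGT hab] with s hs
      exact (hx' s hs).deriv.symm
    · exact (hx' t ⟨hat, htb⟩).hasDerivWithinAt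
  have hf : ∀ t, HasDerivAt (fun t => flow A B (x a) z (t - a))
      (A *ᵥ flow A B (x a) z (t - a) + B *ᵥ z) t := fun t =>
    (hasDerivAt_flow A B (x a) z (t - a)).comp_sub_const t a
  intro t ht
  have := hA.le_gronwallBound hp (x := fun t => x t - flow A B (x a) z (t - a)) (u := fun _ => 0)
    (a := a) (b := b) (ε := 0)
    (hx.sub fun s _ => (hf s).continuousAt.continuousWithinAt)
    (fun s hs => by
      refine ((hr s hs).sub (hf s).hasDerivWithinAt).congr_deriv ?_
      rw [Matrix.mulVec_sub]
      abel)
    (fun _ _ => by simp) t ht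
  simp only [sub_self, flow_zero, map_zero, gronwallBound_ε0_δ0] at this
  exact sub_eq_zero.1 (hp _ (le_antisymm this (apply_nonneg p _)))

end Flow

/-! ### The exact discretization. -/

section Sampling

variable {nx nz : ℕ} {A : Matrix (Fin nx) (Fin nx) ℝ} {B : Matrix (Fin nx) (Fin nz) ℝ}
  {C : Matrix (Fin nz) (Fin nx) ℝ} {D : Matrix (Fin nz) (Fin nz) ℝ}

lemma sum_pow_mul_eq (hD : IsUnit (1 - D)) (n : ℕ) :
    ∑ i ∈ Finset.range n, D ^ i * C = (1 - D ^ n) * (1 - D)⁻¹ * C := by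
  rw [← Matrix.sum_mul, ← geom_sum_mul_neg D n, mul_assoc (∑ i ∈ Finset.range n, D ^ i),
    Matrix.mul_nonsing_inv _ ((Matrix.isUnit_iff_isUnit_det _).1 hD), mul_one]

lemma transition_mulVec (n : ℕ) (T : ℝ) (x : Fin nx → ℝ) (z : Fin nz → ℝ) :
    transition A B C D n T *ᵥ Sum.elim x z = Sum.elim (flow A B x z T)
      (((1 - D ^ n) * (1 - D)⁻¹ * C) *ᵥ flow A B x z T + D ^ n *ᵥ z) := by
  rw [transition, Matrix.fromBlocks_mulVec]
  simp only [Sum.elim_comp_inl, Sum.elim_comp_inr, flow, Matrix.mulVec_add, Matrix.add_mulVec,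
    Matrix.mulVec_mulVec, Matrix.mul_assoc, add_assoc]

variable {n : ℕ} {T : ℝ} {x : ℝ → Fin nx → ℝ} {z : ℝ → Fin nz → ℝ}

lemma IsSolution.eq_flow (h : IsSolution A B C D n T x z) (hT : 0 < T)
    {p : Seminorm ℝ (Fin nx → ℝ)} (hp : IsNorm p) {c : ℝ} (hA : LogNormLE p A c) (k : ℕ) {s : ℝ}
    (hs : s ∈ Set.Icc 0 T) :
    x (k * T + s) = flow A B (x (k * T)) (z (k * T)) s := by
  obtain ⟨zs, -, hz⟩ := h.sampled
  have hlt : (k : ℝ) * T < (k + 1) * T := by linarith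
  have h0 : (0 : ℝ) ≤ k * T := by positivity
  have := SampledLTI.eq_flow A B hp hA (z := z (k * T)) hlt
    (h.continuousOn.mono fun t ht => h0.trans ht.1)
    (fun t ht => by
      rw [hz k (k * T) ⟨le_rfl, hlt⟩, ← hz k t ⟨ht.1.le, ht.2⟩]
      exact h.ode k t ht)
    (k * T + s) ⟨by linarith [hs.1], by linarith [hs.2]⟩
  rwa [add_sub_cancel_left] at this

lemma IsSolution.state_succ (h : IsSolution A B C D n T x z) (hT : 0 < T)
    {p : Seminorm ℝ (Fin nx → ℝ)} (hp : IsNorm p) {c : ℝ} (hA : LogNormLE p A c)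
    (hD : IsUnit (1 - D)) (k : ℕ) :
    state x z ((k + 1 : ℕ) * T) = transition A B C D n T *ᵥ state x z (k * T) := by
  have hx := h.eq_flow hT hp hA k ⟨hT.le, le_rfl⟩
  obtain ⟨zs, hzs, hz⟩ := h.sampled
  have hz' : ∀ k : ℕ, z (k * T) = zs k := fun k => hz k _ ⟨le_rfl, by linarith⟩
  have e : ((k + 1 : ℕ) : ℝ) * T = k * T + T := by push_cast; ring
  rw [state, state, transition_mulVec, hz' (k + 1), hzs, ← hz' k, sum_pow_mul_eq hD, e, hx,
    show ((k : ℝ) + 1) * T = k * T + T by ring, hx]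

lemma IsSolution.state_eq_pow (h : IsSolution A B C D n T x z) (hT : 0 < T)
    {p : Seminorm ℝ (Fin nx → ℝ)} (hp : IsNorm p) {c : ℝ} (hA : LogNormLE p A c)
    (hD : IsUnit (1 - D)) (k : ℕ) :
    state x z (k * T) = transition A B C D n T ^ k *ᵥ state x z 0 := by
  induction k with
  | zero => simp
  | succ k ih => rw [h.state_succ hT hp hA hD, ih, Matrix.mulVec_mulVec, ← pow_succ']

end Sampling

/-! ### The growth factor `φ`. -/

section GronwallFactor

lemma gronwallBound_eq_mul (K ε t : ℝ) : gronwallBound 0 K ε t = ε * gronwallBound 0 K 1 t := by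
  unfold gronwallBound
  split_ifs <;> ring

lemma monotone_gronwallBound (K : ℝ) : Monotone (gronwallBound 0 K 1) := by
  refine monotone_of_deriv_nonneg
    (fun t => (hasDerivAt_gronwallBound 0 K 1 t).differentiableAt) fun t => ?_
  rw [(hasDerivAt_gronwallBound 0 K 1 t).deriv]
  unfold gronwallBound
  split_ifs with h
  · simp [h]
  · have : K * (0 * Real.exp (K * t) + 1 / K * (Real.exp (K * t) - 1)) + 1 = Real.exp (K * t) := by
      field_simp
      ring
    rw [this]
    positivity

lemma gronwallBound_nonneg (K : ℝ) {t : ℝ} (ht : 0 ≤ t) : 0 ≤ gronwallBound 0 K 1 t := by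
  simpa [gronwallBound_x0] using monotone_gronwallBound K ht

lemma gronwallBound_neg (δ ε t : ℝ) {ζ : ℝ} (hζ : 0 < ζ) : gronwallBound δ (-ζ) ε t
    = δ * Real.exp (-ζ * t) + ε * ((1 - Real.exp (-ζ * t)) / ζ) := by
  rw [gronwallBound_of_K_ne_0 (neg_ne_zero.2 hζ.ne')]
  field_simp
  ring

end GronwallFactor

/-- A nonnegative two-by-two matrix with diagonal below one and `det (1 - M) > 0` contracts a
weighted `ℓ¹` norm. -/
lemma exists_weight_of_mul_lt {m₁₁ m₁₂ m₂₁ m₂₂ : ℝ} (h₁₁ : 0 ≤ m₁₁) (h₁₂ : 0 ≤ m₁₂) (h₂₁ : 0 ≤ m₂₁)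
    (h₂₂' : m₂₂ < 1) (h : m₁₂ * m₂₁ < (1 - m₁₁) * (1 - m₂₂)) :
    ∃ β c : ℝ, 0 < β ∧ 0 ≤ c ∧ c < 1 ∧ m₁₁ + β * m₂₁ ≤ c ∧ m₁₂ + β * m₂₂ ≤ c * β := by
  have hd : 0 < 1 - m₂₂ := by linarith
  -- `β₀` gives equality in `m₁₂ + β m₂₂ ≤ β`, and the determinant condition leaves slack in the
  -- other inequality. Adding a small `δ` makes both strict; the `+ 1` in its denominator covers
  -- `m₂₁ = 0`.
  set β₀ := m₁₂ / (1 - m₂₂) with hβ₀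
  have hβ₀' : β₀ * (1 - m₂₂) = m₁₂ := by rw [hβ₀]; field_simp
  have hβ₀0 : 0 ≤ β₀ := by positivity
  have hg : 0 < 1 - m₁₁ - β₀ * m₂₁ := by
    refine pos_of_mul_pos_left ?_ hd.le
    have : (1 - m₁₁ - β₀ * m₂₁) * (1 - m₂₂)
        = (1 - m₁₁) * (1 - m₂₂) - β₀ * (1 - m₂₂) * m₂₁ := by ring
    rw [this, hβ₀']
    linarith
  set δ := (1 - m₁₁ - β₀ * m₂₁) / (m₂₁ + 1) with hδ
  have hδ0 : 0 < δ := by positivity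
  have hδm : δ * m₂₁ < 1 - m₁₁ - β₀ * m₂₁ := by
    have : δ * (m₂₁ + 1) = 1 - m₁₁ - β₀ * m₂₁ := by rw [hδ]; field_simp
    linarith
  have hβ : 0 < β₀ + δ := by linarith
  refine ⟨β₀ + δ, max (m₁₁ + (β₀ + δ) * m₂₁) ((m₁₂ + (β₀ + δ) * m₂₂) / (β₀ + δ)), hβ,
    le_max_of_le_left (by positivity), max_lt (by linarith) ?_, le_max_left _ _, ?_⟩
  · rw [div_lt_one hβ]
    nlinarith [mul_pos hδ0 hd]
  · rw [← div_le_iff₀ hβ]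
    exact le_max_right _ _

/-! ### Estimates over one sampling period. -/

namespace Gains

variable {nx nz : ℕ} {g : Gains nx nz} {A : Matrix (Fin nx) (Fin nx) ℝ}
  {B : Matrix (Fin nx) (Fin nz) ℝ} {C : Matrix (Fin nz) (Fin nx) ℝ}
  {D : Matrix (Fin nz) (Fin nz) ℝ}

namespace IsValid

lemma lipXf_nonneg (hg : g.IsValid A B C D) : 0 ≤ g.lipXf :=
  (opNorm_nonneg A).trans hg.lipXf_bound

lemma lipZG_nonneg (hg : g.IsValid A B C D) : 0 ≤ g.lipZG :=
  (opNorm_nonneg D).trans hg.lipZG_bound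

lemma C₁_pos (hg : g.IsValid A B C D) : 0 < g.C₁ := by
  have h1 := hg.lipXf_nonneg
  have h2 := hg.lipZf_pos
  have h3 := hg.lipXG_pos
  have h4 := sub_pos.2 hg.lipZG_lt_one
  unfold C₁
  positivity

lemma C₂_nonneg (hg : g.IsValid A B C D) (n : ℕ) : 0 ≤ g.C₂ n := by
  have h1 := hg.lipZG_nonneg
  have h2 := hg.lipZf_pos
  have h3 := hg.lipXG_pos
  have h4 := sub_pos.2 hg.lipZG_lt_one
  unfold C₂
  positivity

lemma denom_pos (hg : g.IsValid A B C D) (n : ℕ) : 0 < g.C₂ n + g.C₁ / g.zeta :=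
  add_pos_of_nonneg_of_pos (hg.C₂_nonneg n) (div_pos hg.C₁_pos hg.zeta_pos)

lemma pow_lt_one (hg : g.IsValid A B C D) {n : ℕ} (hn : 0 < n) : g.lipZG ^ n < 1 :=
  pow_lt_one₀ hg.lipZG_nonneg hg.lipZG_lt_one hn.ne'

lemma samplingBound_pos (hg : g.IsValid A B C D) {n : ℕ} (hn : 0 < n) :
    0 < g.samplingBound n := by
  have hd := hg.denom_pos n
  have hq := sub_pos.2 (hg.pow_lt_one hn)
  unfold samplingBound
  split_ifs with h0 h1
  · exact EReal.coe_pos.2 (by positivity)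
  · refine EReal.coe_pos.2 ?_
    rcases lt_or_gt_of_ne h0 with hneg | hpos
    · refine mul_pos_of_neg_of_neg (one_div_neg.2 hneg) (Real.log_neg h1 ?_)
      have : g.xi * (1 - g.lipZG ^ n) / (g.C₂ n + g.C₁ / g.zeta) < 0 :=
        div_neg_of_neg_of_pos (mul_neg_of_neg_of_pos hneg hq) hd
      unfold logArg
      linarith
    · refine mul_pos (one_div_pos.2 hpos) (Real.log_pos ?_)
      have : 0 < g.xi * (1 - g.lipZG ^ n) / (g.C₂ n + g.C₁ / g.zeta) := by positivity
      unfold logArg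
      linarith
  · exact EReal.coe_lt_top 0

/-- The logarithmic formula for `T(n)` inverts the increasing function `φ`; this is the only form in
which the bound on `T` is used. -/
lemma gronwallBound_mul_lt (hg : g.IsValid A B C D) {n : ℕ} (hn : 0 < n) {T : ℝ}
    (h : (T : EReal) < g.samplingBound n) :
    gronwallBound 0 g.xi 1 T * (g.C₂ n + g.C₁ / g.zeta) < 1 - g.lipZG ^ n := by
  have hd := hg.denom_pos n
  have hq := sub_pos.2 (hg.pow_lt_one hn)
  rw [← lt_div_iff₀ hd]
  have harg : g.logArg n = g.xi * ((1 - g.lipZG ^ n) / (g.C₂ n + g.C₁ / g.zeta)) + 1 := by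
    rw [logArg, mul_div_assoc]
  have hpos := div_pos hq hd
  unfold samplingBound at h
  by_cases h0 : g.xi = 0
  · rw [if_pos h0, EReal.coe_lt_coe_iff] at h
    rw [h0, gronwallBound_K0]
    simpa using h
  rw [if_neg h0] at h
  rw [gronwallBound_of_K_ne_0 h0]
  simp only [zero_mul, zero_add]
  rw [one_div, inv_mul_eq_div]
  rcases lt_or_gt_of_ne h0 with hneg | hxi
  · have key : g.logArg n < Real.exp (g.xi * T) := by
      split_ifs at h with h1
      · rw [EReal.coe_lt_coe_iff, one_div, inv_mul_eq_div, lt_div_iff_of_neg hneg] at h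
        rwa [← Real.log_lt_iff_lt_exp h1, mul_comm]
      -- Here `T(n) = ⊤`, and the inequality holds for every `T`.
      · exact (not_lt.1 h1).trans_lt (Real.exp_pos _)
    rw [div_lt_iff_of_neg hneg]
    linarith
  · have h1 : 0 < g.logArg n := by rw [harg]; positivity
    rw [if_pos h1, EReal.coe_lt_coe_iff, one_div, inv_mul_eq_div, lt_div_iff₀ hxi,
      Real.lt_log_iff_exp_lt h1] at h
    rw [div_lt_iff₀ hxi]
    rw [mul_comm T] at h
    linarith

/-- A kernel vector satisfies `v = D v`, which a contraction allows only for `v = 0`. -/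
lemma isUnit_one_sub (hg : g.IsValid A B C D) : IsUnit (1 - D) := by
  rw [Matrix.isUnit_iff_isUnit_det, isUnit_iff_ne_zero]
  intro h0
  obtain ⟨v, hv, h⟩ := Matrix.exists_mulVec_eq_zero_iff.2 h0
  rw [Matrix.sub_mulVec, Matrix.one_mulVec, sub_eq_zero] at h
  have h1 := hg.isNorm_normZ.mulVec_le_of_opNorm_le hg.lipZG_bound v
  rw [← h] at h1
  refine hv (hg.isNorm_normZ v (le_antisymm ?_ (apply_nonneg _ v)))
  have := hg.lipZG_lt_one
  nlinarith [apply_nonneg g.normZ v]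

/-- Lipschitz bound for the equilibrium map `x ↦ (1 - D)⁻¹ C x`. -/
lemma normZ_equilibrium_le (hg : g.IsValid A B C D) (x : Fin nx → ℝ) :
    g.normZ (((1 - D)⁻¹ * C) *ᵥ x) ≤ g.lipXG / (1 - g.lipZG) * g.normX x := by
  set u := ((1 - D)⁻¹ * C) *ᵥ x with hu
  have h : u = C *ᵥ x + D *ᵥ u := by
    have : (1 - D) *ᵥ u = C *ᵥ x := by
      rw [hu, Matrix.mulVec_mulVec, Matrix.mul_nonsing_inv_cancel_left _ _
        ((Matrix.isUnit_iff_isUnit_det _).1 hg.isUnit_one_sub)]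
    rw [← this, Matrix.sub_mulVec, Matrix.one_mulVec, sub_add_cancel]
  have h1 := hg.isNorm_normX.mulVec_le_of_opNorm_le hg.lipXG_bound x
  have h2 := hg.isNorm_normZ.mulVec_le_of_opNorm_le hg.lipZG_bound u
  have h3 : g.normZ u ≤ g.normZ (C *ᵥ x) + g.normZ (D *ᵥ u) := by
    conv_lhs => rw [h]
    exact map_add_le_add _ _ _
  rw [div_mul_eq_mul_div, le_div_iff₀ (sub_pos.2 hg.lipZG_lt_one)]
  linarith

lemma normZ_pow_mulVec_le (hg : g.IsValid A B C D) (n : ℕ) (v : Fin nz → ℝ) :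
    g.normZ (D ^ n *ᵥ v) ≤ g.lipZG ^ n * g.normZ v := by
  have h0 := hg.lipZG_nonneg
  induction n with
  | zero => simp
  | succ n ih =>
    rw [pow_succ', ← Matrix.mulVec_mulVec, pow_succ', mul_assoc]
    exact (hg.isNorm_normZ.mulVec_le_of_opNorm_le hg.lipZG_bound _).trans (by gcongr)

variable (x₀ : Fin nx → ℝ) (z : Fin nz → ℝ)

lemma normX_velocity_le (hg : g.IsValid A B C D) :
    g.normX (A *ᵥ x₀ + B *ᵥ z) ≤
      (g.lipXf + g.lipZf * (g.lipXG / (1 - g.lipZG))) * g.normX x₀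
        + g.lipZf * g.normZ (z - ((1 - D)⁻¹ * C) *ᵥ x₀) := by
  have e : A *ᵥ x₀ + B *ᵥ z = A *ᵥ x₀ + (B *ᵥ (((1 - D)⁻¹ * C) *ᵥ x₀)
      + B *ᵥ (z - ((1 - D)⁻¹ * C) *ᵥ x₀)) := by
    rw [← Matrix.mulVec_add, add_sub_cancel]
  rw [e]
  have h0 := hg.lipZf_pos
  have h1 := hg.isNorm_normX.mulVec_le_of_opNorm_le hg.lipXf_bound x₀
  have h2 := hg.isNorm_normZ.mulVec_le_of_opNorm_le hg.lipZf_bound (((1 - D)⁻¹ * C) *ᵥ x₀)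
  have h3 := hg.isNorm_normZ.mulVec_le_of_opNorm_le hg.lipZf_bound (z - ((1 - D)⁻¹ * C) *ᵥ x₀)
  have h4 := mul_le_mul_of_nonneg_left (hg.normZ_equilibrium_le x₀) h0.le
  have h5 := map_add_le_add g.normX (A *ᵥ x₀) (B *ᵥ (((1 - D)⁻¹ * C) *ᵥ x₀)
      + B *ᵥ (z - ((1 - D)⁻¹ * C) *ᵥ x₀))
  have h6 := map_add_le_add g.normX (B *ᵥ (((1 - D)⁻¹ * C) *ᵥ x₀))
    (B *ᵥ (z - ((1 - D)⁻¹ * C) *ᵥ x₀))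
  linarith

/-- The displacement starts at zero and solves the equation of `A` forced by the constant initial
velocity, so `ξ` governs its growth. -/
lemma normX_flow_sub_le (hg : g.IsValid A B C D) {t T : ℝ} (ht : t ∈ Set.Icc 0 T) :
    g.normX (flow A B x₀ z t - x₀)
      ≤ g.normX (A *ᵥ x₀ + B *ᵥ z) * gronwallBound 0 g.xi 1 T := by
  have hd : ∀ t, HasDerivAt (fun t => flow A B x₀ z t - x₀)
      (A *ᵥ (flow A B x₀ z t - x₀) + (A *ᵥ x₀ + B *ᵥ z)) t := fun t => by
    refine ((hasDerivAt_flow A B x₀ z t).sub_const x₀).congr_deriv ?_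
    rw [Matrix.mulVec_sub]
    abel
  have := hg.xi_bound.le_gronwallBound hg.isNorm_normX (u := fun _ => A *ᵥ x₀ + B *ᵥ z)
    (fun t _ => (hd t).continuousAt.continuousWithinAt) (fun t _ => (hd t).hasDerivWithinAt)
    (fun _ _ => le_rfl) t ht
  rw [flow_zero, sub_self, map_zero, sub_zero, gronwallBound_eq_mul] at this
  exact this.trans (mul_le_mul_of_nonneg_left (monotone_gronwallBound _ ht.2) (apply_nonneg _ _))

lemma normZ_sub_flow_le (hg : g.IsValid A B C D) {t T : ℝ} (ht : t ∈ Set.Icc 0 T) :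
    g.normZ (z - ((1 - D)⁻¹ * C) *ᵥ flow A B x₀ z t) ≤
      g.normZ (z - ((1 - D)⁻¹ * C) *ᵥ x₀) + g.lipXG / (1 - g.lipZG) *
        (g.normX (A *ᵥ x₀ + B *ᵥ z) * gronwallBound 0 g.xi 1 T) := by
  have hL : 0 ≤ g.lipXG / (1 - g.lipZG) :=
    (div_pos hg.lipXG_pos (sub_pos.2 hg.lipZG_lt_one)).le
  have e : z - ((1 - D)⁻¹ * C) *ᵥ flow A B x₀ z t = (z - ((1 - D)⁻¹ * C) *ᵥ x₀)
      - ((1 - D)⁻¹ * C) *ᵥ (flow A B x₀ z t - x₀) := by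
    rw [Matrix.mulVec_sub]
    abel
  rw [e]
  refine (map_sub_le_add _ _ _).trans (add_le_add_right ?_ _)
  exact (hg.normZ_equilibrium_le _).trans
    (mul_le_mul_of_nonneg_left (hg.normX_flow_sub_le x₀ z ht) hL)

/-- Rewriting `A x + B z` as the reduced vector field plus `B w` lets Grönwall run with rate `-ζ`
and a uniform bound on `w`. -/
lemma normX_flow_le (hg : g.IsValid A B C D) {T : ℝ} (hT : 0 ≤ T) :
    g.normX (flow A B x₀ z T) ≤ g.normX x₀ * Real.exp (-g.zeta * T) +
      g.lipZf * (g.normZ (z - ((1 - D)⁻¹ * C) *ᵥ x₀) + g.lipXG / (1 - g.lipZG) *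
        (g.normX (A *ᵥ x₀ + B *ᵥ z) * gronwallBound 0 g.xi 1 T)) *
        ((1 - Real.exp (-g.zeta * T)) / g.zeta) := by
  have hd : ∀ t, HasDerivAt (flow A B x₀ z)
      (reducedMatrix A B C D *ᵥ flow A B x₀ z t
        + B *ᵥ (z - ((1 - D)⁻¹ * C) *ᵥ flow A B x₀ z t)) t := fun t => by
    refine (hasDerivAt_flow A B x₀ z t).congr_deriv ?_
    rw [reducedMatrix, Matrix.mulVec_sub, Matrix.add_mulVec, Matrix.mulVec_mulVec,
      ← Matrix.mul_assoc]
    abel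
  have := hg.zeta_bound.le_gronwallBound hg.isNorm_normX
    (fun t _ => (hd t).continuousAt.continuousWithinAt) (fun t _ => (hd t).hasDerivWithinAt)
    (fun t ht => (hg.isNorm_normZ.mulVec_le_of_opNorm_le hg.lipZf_bound _).trans
      (mul_le_mul_of_nonneg_left
        (hg.normZ_sub_flow_le x₀ z (T := T) ⟨ht.1, ht.2.le⟩) hg.lipZf_pos.le))
    T ⟨hT, le_rfl⟩
  rwa [flow_zero, sub_zero, gronwallBound_neg _ _ _ hg.zeta_pos] at this

end IsValid

/-- The norm `‖x‖ + β ‖z - (1 - D)⁻¹ C x‖` on the full state space. -/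
def deviationNorm (g : Gains nx nz) (C : Matrix (Fin nz) (Fin nx) ℝ)
    (D : Matrix (Fin nz) (Fin nz) ℝ) (β : NNReal) : Seminorm ℝ (Fin nx ⊕ Fin nz → ℝ) :=
  g.normX.comp (LinearMap.funLeft ℝ ℝ Sum.inl) + β • g.normZ.comp
    (LinearMap.funLeft ℝ ℝ Sum.inr - ((1 - D)⁻¹ * C).mulVecLin ∘ₗ LinearMap.funLeft ℝ ℝ Sum.inl)

lemma deviationNorm_elim (β : NNReal) (x : Fin nx → ℝ) (z : Fin nz → ℝ) :
    g.deviationNorm C D β (Sum.elim x z)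
      = g.normX x + β * g.normZ (z - ((1 - D)⁻¹ * C) *ᵥ x) := rfl

lemma IsValid.isNorm_deviationNorm (hg : g.IsValid A B C D) {β : NNReal} (hβ : 0 < β) :
    IsNorm (g.deviationNorm C D β) := by
  intro v hv
  rw [← Sum.elim_comp_inl_inr v, deviationNorm_elim,
    add_eq_zero_iff_of_nonneg (apply_nonneg g.normX _)
      (mul_nonneg β.coe_nonneg (apply_nonneg g.normZ _))] at hv
  have hx := hg.isNorm_normX _ hv.1
  have hz := hg.isNorm_normZ _ ((mul_eq_zero.1 hv.2).resolve_left (by exact_mod_cast hβ.ne'))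
  rw [hx, Matrix.mulVec_zero, sub_zero] at hz
  rw [← Sum.elim_comp_inl_inr v, hx, hz]
  ext (i | i) <;> rfl

/-- Below the sampling bound, the transition matrix contracts a norm. -/
lemma IsValid.exists_transition_contraction (hg : g.IsValid A B C D) {n : ℕ} (hn : 0 < n) {T : ℝ}
    (hT : 0 < T) (hTn : (T : EReal) < g.samplingBound n) :
    ∃ (N : Seminorm ℝ (Fin nx ⊕ Fin nz → ℝ)) (c : ℝ), IsNorm N ∧ 0 ≤ c ∧ c < 1 ∧
      ∀ v, N (transition A B C D n T *ᵥ v) ≤ c * N v := by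
  have hkey := hg.gronwallBound_mul_lt hn hTn
  have hφ := gronwallBound_nonneg g.xi hT.le
  have hq0 : 0 ≤ g.lipZG ^ n := pow_nonneg hg.lipZG_nonneg n
  have hB := hg.lipZf_pos
  have hA := hg.lipXf_nonneg
  have hζ := hg.zeta_pos
  have hL : 0 < g.lipXG / (1 - g.lipZG) := div_pos hg.lipXG_pos (sub_pos.2 hg.lipZG_lt_one)
  have hC₁ : g.C₁ = g.lipZf * (g.lipXG / (1 - g.lipZG))
      * (g.lipXf + g.lipZf * (g.lipXG / (1 - g.lipZG))) := by
    rw [C₁]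
    ring
  have hC₂ : g.C₂ n = g.lipZG ^ n * (g.lipXG / (1 - g.lipZG) * g.lipZf) := by
    rw [C₂]
    ring
  have hX := fun x z => hg.normX_flow_le x z hT.le
  have hZ := fun x z => hg.normZ_sub_flow_le x z (T := T) ⟨hT.le, le_rfl⟩
  have hV := fun x z => hg.normX_velocity_le x z
  set φ := gronwallBound 0 g.xi 1 T
  set q := g.lipZG ^ n
  set L := g.lipXG / (1 - g.lipZG)
  set b := g.lipZf
  set S := g.lipXf + b * L
  set ζ := g.zeta
  set e := Real.exp (-ζ * T)
  have he1 : 0 < 1 - e := by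
    have : e < 1 := Real.exp_lt_one_iff.2 (by nlinarith)
    linarith
  have he0 : 0 < e := Real.exp_pos _
  set σ := (1 - e) / ζ with hσ
  have hσ0 : 0 < σ := by positivity
  have hσζ : σ * ζ = 1 - e := by rw [hσ]; field_simp
  have hS : 0 ≤ S := by positivity
  set a := b * L * S * φ / ζ with ha
  have ha0 : 0 ≤ a := by positivity
  have haζ : a * ζ = b * L * S * φ := by rw [ha]; field_simp
  have hkey' : q * (b * L * φ) + a < 1 - q := by
    have : φ * (g.C₂ n + g.C₁ / ζ) = q * (b * L * φ) + a := by
      rw [hC₁, hC₂, ha]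
      ring
    linarith
  have hbL : 0 ≤ b * L * φ := by positivity
  have hqbL : 0 ≤ q * (b * L * φ) := by positivity
  obtain ⟨β, c, hβ, hc0, hc1, hcX, hcZ⟩ := exists_weight_of_mul_lt
    (m₁₁ := e + b * σ * (L * φ * S)) (m₁₂ := b * σ * (1 + L * φ * b))
    (m₂₁ := q * (L * φ * S)) (m₂₂ := q * (1 + L * φ * b))
    (by positivity) (by positivity) (by positivity) (by linarith) (by
      -- Both sides of the determinant condition carry the factor `1 - e`; the `a q` terms then
      -- cancel, leaving exactly `hkey'`.
      have e1 : (1 - (e + b * σ * (L * φ * S))) = (1 - e) * (1 - a) := by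
        have : b * σ * (L * φ * S) = (1 - e) * a := by
          rw [← hσζ, show b * σ * (L * φ * S) = σ * (b * L * S * φ) by ring, ← haζ]
          ring
        rw [this]
        ring
      have e2 : b * σ * (1 + L * φ * b) * (q * (L * φ * S))
          = (1 - e) * (a * q * (1 + b * L * φ)) := by
        rw [← hσζ, show b * σ * (1 + L * φ * b) * (q * (L * φ * S))
          = σ * (b * L * S * φ) * q * (1 + b * L * φ) by ring, ← haζ]
        ring
      rw [e1, e2, mul_assoc (1 - e)]
      refine mul_lt_mul_of_pos_left ?_ he1
      have e3 : (1 - a) * (1 - q * (1 + L * φ * b)) - a * q * (1 + b * L * φ)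
          = 1 - q - (q * (b * L * φ) + a) := by ring
      linarith)
  lift β to NNReal using hβ.le
  refine ⟨g.deviationNorm C D β, c, hg.isNorm_deviationNorm (NNReal.coe_pos.1 hβ), hc0, hc1, fun v => ?_⟩
  rw [← Sum.elim_comp_inl_inr v, transition_mulVec, deviationNorm_elim, deviationNorm_elim]
  set x := v ∘ Sum.inl
  set z := v ∘ Sum.inr
  specialize hX x z
  specialize hZ x z
  specialize hV x z
  set F := flow A B x z T
  -- The sampled update multiplies the deviation from the equilibrium of the new `x` by `D ^ n`.
  have hdev : ((1 - D ^ n) * (1 - D)⁻¹ * C) *ᵥ F + D ^ n *ᵥ z - ((1 - D)⁻¹ * C) *ᵥ F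
      = D ^ n *ᵥ (z - ((1 - D)⁻¹ * C) *ᵥ F) := by
    rw [Matrix.mul_assoc, ← Matrix.mulVec_mulVec, Matrix.sub_mulVec, Matrix.one_mulVec,
      Matrix.mulVec_sub]
    abel
  rw [hdev]
  have hpow := hg.normZ_pow_mulVec_le n (z - ((1 - D)⁻¹ * C) *ᵥ F)
  have hP := apply_nonneg g.normX x
  have hQ := apply_nonneg g.normZ (z - ((1 - D)⁻¹ * C) *ᵥ x)
  set P := g.normX x
  set Q := g.normZ (z - ((1 - D)⁻¹ * C) *ᵥ x)
  set V := g.normX (A *ᵥ x + B *ᵥ z)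
  set W := Q + L * (V * φ)
  have hW : W ≤ (L * φ * S) * P + (1 + L * φ * b) * Q := by
    have : L * (V * φ) ≤ L * ((S * P + b * Q) * φ) := by gcongr
    linarith
  have hZ' : g.normZ (D ^ n *ᵥ (z - ((1 - D)⁻¹ * C) *ᵥ F)) ≤ q * W :=
    hpow.trans (by gcongr)
  change g.normX F + β * _ ≤ c * (P + β * Q)
  calc _ ≤ (P * e + b * W * σ) + β * (q * W) := by gcongr
    _ = P * e + (b * σ + β * q) * W := by ring
    _ ≤ P * e + (b * σ + β * q) * ((L * φ * S) * P + (1 + L * φ * b) * Q) := by gcongr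
    _ = (e + b * σ * (L * φ * S) + β * (q * (L * φ * S))) * P
        + (b * σ * (1 + L * φ * b) + β * (q * (1 + L * φ * b))) * Q := by ring
    _ ≤ c * P + c * β * Q := by gcongr
    _ = _ := by ring

/-- Over one sampling interval the state grows by at most a constant factor, in any norm. -/
lemma IsValid.exists_flow_le (hg : g.IsValid A B C D) {T : ℝ} (hT : 0 ≤ T)
    {N : Seminorm ℝ (Fin nx ⊕ Fin nz → ℝ)} (hN : IsNorm N) :
    ∃ K, 0 < K ∧ ∀ x z, ∀ t ∈ Set.Icc 0 T,
      N (Sum.elim (flow A B x z t) z) ≤ K * N (Sum.elim x z) := by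
  have hN₁ := hg.isNorm_deviationNorm one_pos
  obtain ⟨K₁, hK₁, h₁⟩ := hN₁.seminorm_le_mul N
  obtain ⟨K₂, hK₂, h₂⟩ := hN.seminorm_le_mul (g.deviationNorm C D 1)
  have hφ := gronwallBound_nonneg g.xi hT
  have hB := hg.lipZf_pos
  have hA := hg.lipXf_nonneg
  have hL : 0 < g.lipXG / (1 - g.lipZG) := div_pos hg.lipXG_pos (sub_pos.2 hg.lipZG_lt_one)
  have hX := fun x z t ht => hg.normX_flow_sub_le x z (t := t) (T := T) ht
  have hZ := fun x z t ht => hg.normZ_sub_flow_le x z (t := t) (T := T) ht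
  have hV := fun x z => hg.normX_velocity_le x z
  set φ := gronwallBound 0 g.xi 1 T
  set L := g.lipXG / (1 - g.lipZG)
  set b := g.lipZf
  set S := g.lipXf + b * L
  have hS : 0 ≤ S := by positivity
  refine ⟨K₁ * (1 + (1 + L) * φ * (S + b)) * K₂, by positivity, fun x z t ht => ?_⟩
  specialize hX x z t ht
  specialize hZ x z t ht
  specialize hV x z
  have hF := map_add_le_add g.normX (flow A B x z t - x) x
  rw [sub_add_cancel] at hF
  have hstep : g.deviationNorm C D 1 (Sum.elim (flow A B x z t) z)
      ≤ (1 + (1 + L) * φ * (S + b)) * g.deviationNorm C D 1 (Sum.elim x z) := by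
    rw [deviationNorm_elim, deviationNorm_elim, NNReal.coe_one, one_mul, one_mul]
    have hP := apply_nonneg g.normX x
    have hQ := apply_nonneg g.normZ (z - ((1 - D)⁻¹ * C) *ᵥ x)
    set P := g.normX x
    set Q := g.normZ (z - ((1 - D)⁻¹ * C) *ᵥ x)
    set V := g.normX (A *ᵥ x + B *ᵥ z)
    have hV' : V ≤ (S + b) * (P + Q) := by nlinarith [mul_nonneg hS hQ, mul_nonneg hB.le hP]
    have : (1 + L) * φ * V ≤ (1 + L) * φ * ((S + b) * (P + Q)) := by gcongr
    linarith
  calc _ ≤ _ := h₁ _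
    _ ≤ K₁ * ((1 + (1 + L) * φ * (S + b)) * (K₂ * N (Sum.elim x z))) := by
        gcongr
        exact hstep.trans (by gcongr; exact h₂ _)
    _ = _ := by ring

end Gains

/-- With rate `-log c / T` the exponential at time `(k + 1) T` is `c ^ (k + 1)`; the factor `c⁻¹`
pays for the unfinished period. -/
lemma pow_le_exp_neg_mul {c T : ℝ} (hc : 0 < c) (hc1 : c < 1) (hT : 0 < T) {k : ℕ} {t : ℝ}
    (ht : t ≤ (k + 1) * T) :
    c ^ k ≤ c⁻¹ * Real.exp (-(-Real.log c / T * t)) := by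
  have hlog := Real.log_neg hc hc1
  rw [inv_mul_eq_div, le_div_iff₀ hc, ← pow_succ, ← Real.exp_log (pow_pos hc (k + 1)),
    Real.exp_le_exp, Real.log_pow]
  have h : t / T ≤ k + 1 := (div_le_iff₀ hT).2 ht
  have e : -(-Real.log c / T * t) = t / T * Real.log c := by ring
  rw [e]
  push_cast
  exact mul_le_mul_of_nonpos_right h hlog.le

/-! ### From sampling instants to continuous time. -/

section Stability

variable {nx nz : ℕ} {g : Gains nx nz} {A : Matrix (Fin nx) (Fin nx) ℝ}
  {B : Matrix (Fin nx) (Fin nz) ℝ} {C : Matrix (Fin nz) (Fin nx) ℝ}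
  {D : Matrix (Fin nz) (Fin nz) ℝ} {n : ℕ} {T : ℝ}

/-- Geometric decay at the sampling instants gives exponential stability in continuous time. -/
lemma originGES_of_transition_contraction (hg : g.IsValid A B C D) (hT : 0 < T)
    {N : Seminorm ℝ (Fin nx ⊕ Fin nz → ℝ)} (hN : IsNorm N) {c : ℝ} (hc : 0 < c) (hc1 : c < 1)
    (h : ∀ (k : ℕ) v, N (transition A B C D n T ^ k *ᵥ v) ≤ c ^ k * N v) :
    OriginGES A B C D n T := by
  intro N' hN'
  obtain ⟨K₁, hK₁, h₁⟩ := hg.exists_flow_le hT.le hN'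
  obtain ⟨K₂, hK₂, h₂⟩ := hN.seminorm_le_mul N'
  obtain ⟨K₃, hK₃, h₃⟩ := hN'.seminorm_le_mul N
  refine ⟨-Real.log c / T, K₁ * K₂ * K₃ * c⁻¹, div_pos (neg_pos.2 (Real.log_neg hc hc1)) hT,
    by positivity, fun x z hxz t ht => ?_⟩
  set k := ⌊t / T⌋₊
  have hk1 : k * T ≤ t := (le_div_iff₀ hT).1 (Nat.floor_le (by positivity))
  have hk2 : t < (k + 1) * T := (div_lt_iff₀ hT).1 (Nat.lt_floor_add_one _)
  have hs : t - k * T ∈ Set.Icc 0 T := ⟨by linarith, by linarith⟩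
  have hx := hxz.eq_flow hT hg.isNorm_normX hg.xi_bound k hs
  rw [add_sub_cancel] at hx
  have hz : z t = z (k * T) := by
    obtain ⟨zs, -, hzs⟩ := hxz.sampled
    rw [hzs k t ⟨hk1, hk2⟩, hzs k (k * T) ⟨le_rfl, by linarith⟩]
  have hy : N' (state x z t) ≤ K₁ * N' (state x z (k * T)) := by
    rw [state, hx, hz]
    exact h₁ _ _ _ hs
  have hyk := hxz.state_eq_pow hT hg.isNorm_normX hg.xi_bound hg.isUnit_one_sub k
  have hpow := pow_le_exp_neg_mul hc hc1 hT hk2.le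
  calc _ ≤ _ := hy
    _ ≤ K₁ * (K₂ * N (state x z (k * T))) := by gcongr; exact h₂ _
    _ ≤ K₁ * (K₂ * (c ^ k * N (state x z 0))) := by rw [hyk]; gcongr; exact h k _
    _ ≤ K₁ * (K₂ * ((c⁻¹ * Real.exp (-(-Real.log c / T * t))) * (K₃ * N' (state x z 0)))) := by
        gcongr
        exact h₃ _
    _ = _ := by ring

end Stability

end SampledLTI

end

theorem proposition2 (nx nz : ℕ) (hnx : 0 < nx) (hnz : 0 < nz)
    (A : Matrix (Fin nx) (Fin nx) ℝ) (B : Matrix (Fin nx) (Fin nz) ℝ)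
    (C : Matrix (Fin nz) (Fin nx) ℝ) (D : Matrix (Fin nz) (Fin nz) ℝ)
    (hRM : SampledLTI.IsHurwitz (SampledLTI.reducedMatrix A B C D))
    (hD : SampledLTI.IsSchur D) :
    (∃ g : SampledLTI.Gains nx nz, g.IsValid A B C D) ∧
    ∀ g : SampledLTI.Gains nx nz, g.IsValid A B C D → ∀ n : ℕ, 0 < n →
      0 < g.samplingBound n ∧
      ∀ T : ℝ, 0 < T → (T : EReal) < g.samplingBound n →
        SampledLTI.IsSchur (SampledLTI.transition A B C D n T) ∧
        (∃ N : Seminorm ℝ (Fin nx ⊕ Fin nz → ℝ), SampledLTI.IsNorm N ∧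
          ∀ x z x' z', SampledLTI.IsSolution A B C D n T x z →
            SampledLTI.IsSolution A B C D n T x' z' →
            ∀ k : ℕ,
              N (SampledLTI.state x z (k * T) - SampledLTI.state x' z' (k * T)) ≤
                ((1 + SampledLTI.specRad (SampledLTI.transition A B C D n T)) / 2) ^ k *
                  N (SampledLTI.state x z 0 - SampledLTI.state x' z' 0)) ∧
        SampledLTI.OriginGES A B C D n T := by
  refine ⟨SampledLTI.exists_gains_isValid hnx hRM hD, fun g hg n hn =>
    ⟨hg.samplingBound_pos hn, fun T hT hTn => ?_⟩⟩
  have : Nonempty (Fin nx ⊕ Fin nz) := ⟨Sum.inl ⟨0, hnx⟩⟩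
  obtain ⟨N₀, c, hN₀, hc0, hc1, hcN₀⟩ := hg.exists_transition_contraction hn hT hTn
  have hS := SampledLTI.isSchur_of_mulVec_le hN₀ hc0 hc1 hcN₀
  -- `N₀` served only to prove the Schur property; the rate `(1 + ρ) / 2` requires a second norm,
  -- adapted to the spectral radius.
  obtain ⟨N, hN, hNle⟩ := hS.exists_isNorm_mulVec_le
  have hρ0 := SampledLTI.specRad_nonneg (SampledLTI.transition A B C D n T)
  have hρ1 := hS.specRad_lt_one
  set r := (1 + SampledLTI.specRad (SampledLTI.transition A B C D n T)) / 2 with hr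
  have hr0 : 0 < r := by linarith
  have hpow : ∀ (k : ℕ) v, N ((SampledLTI.transition A B C D n T ^ k).mulVec v) ≤ r ^ k * N v := by
    intro k v
    induction k with
    | zero => simp
    | succ k ih =>
      rw [pow_succ', ← Matrix.mulVec_mulVec, pow_succ', mul_assoc]
      exact (hNle _).trans (by gcongr)
  refine ⟨hS, ⟨N, hN, fun x z x' z' h h' k => ?_⟩,
    SampledLTI.originGES_of_transition_contraction hg hT hN hr0 (by linarith) hpow⟩
  rw [h.state_eq_pow hT hg.isNorm_normX hg.xi_bound hg.isUnit_one_sub,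
    h'.state_eq_pow hT hg.isNorm_normX hg.xi_bound hg.isUnit_one_sub, ← Matrix.mulVec_sub]
  exact hpow k _
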